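/- Let $G\subseteq K_{m,n}$ be a connected bipartite graph with vertex classes $U_1,U_2$, $|U_1|=m$, $|U_2|=n$. Let $M_{\mathbb Q}=\{x\in\mathbb Q^{m+n}:\sum_{v\in U_1}x_v=\sum_{v\in U_2}x_v\}$ and let $N_{\mathbb Q}=\mathbb Q^{m+n}/\langle\sum_i e_i-\sum_j f_j\rangle$ be its dual space. For a spanning subgraph $H$ of $G$ let $\sigma_H^\vee\subseteq M_{\mathbb Q}$ be the cone generated by the vectors $e^i+f^j$ for the edges $(i,j)$ of $H$, and let $\sigma_G\subseteq N_{\mathbb Q}$ (the edge cone) be the dual cone of $\sigma_G^\vee$. Independent sets are non-empty by convention; write $N(A)$ for the set of neighbours of $A$ and $A_i=A\cap U_i$. An independent set $A$ is two-sided if $\emptyset\ne A_i\subsetneq U_i$ for $i=1,2$. Let $\mathcal I_G^{(*)}$ consist of the two-sided maximal independent sets and of the independent sets $U_i\setminus\{u\}$ ($u\in U_i$) that are contained in no two-sided independent set. For $A\in\mathcal I_G^{(*)}$ let $G\{A\}$ be the spanning subgraph of $G$ whose edges are those of the induced subgraphs on $A_1\cup N(A_1)$ and on $A_2\cup N(A_2)$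 if $A$ is two-sided, and those of the induced subgraphs on $A\cup N(A)$ and on $(U_i\setminus A)\cup(U_j\setminus N(A))$, $\{i,j\}=\{1,2\}$, if $A\subseteq U_i$. Call $A\in\mathcal I_G^{(*)}$ a first independent set if $G\{A\}$ has exactly two connected components; then put $$\pi(A)=\{x\in\sigma_G:\langle y,x\rangle=0\text{ for all }y\in\sigma_G^\vee\text{ with }\textstyle\sum_{v\in A_i}y_v=\sum_{v\in N(A_i)}y_v\},$$ where $i$ is such that $A_i\neq\emptyset$ (this is the extremal ray of $\sigma_G$ corresponding to $A$). Let $S$ be a set of $d$ first independent sets, let $G[S]=\bigcap_{A\in S}G\{A\}$ (with $G[\emptyset]=G$), and let $\mathrm{Val}_S\in M_{\mathbb Q}$ be the degree sequence of $G[S]$. By the face of $\sigma_G$ spanned by $\pi(S)$ we mean the smallest face of $\sigma_G$ containing all the rays $\pi(A)$, $A\in S$. Then: 1. $\pi(S)$ spans a face of dimension $d$ if and only if $\dim\sigma^\vee_{G[S]}=m+n-d-1$, if and only if $G[S]$ has $d+1$ connected components. 2. The face spanned by $\pi(S)$ is $H_{\mathrm{Val}_S}\cap\sigma_G$, where $H_{\mathrm{Val}_S}=\{x\in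 N_{\mathbb Q}:\langle \mathrm{Val}_S,x\rangle=0\}$. 3. In particular, if the cone generated by the rays $\pi(A)$, $A\in S$, is itself a face of $\sigma_G$ of dimension $d$, then $G[S]$ has $d+1$ connected components and this cone equals $H_{\mathrm{Val}_S}\cap\sigma_G$. -/

import Mathlib

/-! Edge cones of bipartite graphs `G ⊆ K_{m,n}`. The vertex set is `Fin m ⊕ Fin n`, with
`U₁` the left and `U₂` the right summand. -/

namespace EdgeCone

/-- The vertex set of `K_{m,n}`. -/
abbrev Vert (m n : ℕ) : Type := Fin m ⊕ Fin n

/-! ### The vector spaces `M_ℚ` and `N_ℚ` -/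

/-- The vector `(1,…,1,-1,…,-1) = ∑ e_i - ∑ f_j`. -/
def signVec (m n : ℕ) : Vert m n → ℚ := Sum.elim (fun _ => 1) (fun _ => -1)

/-- `M_ℚ = ℚ^{m+n} ∩ (1,-1)^⊥`. -/
def MQ (m n : ℕ) : Submodule ℚ (Vert m n → ℚ) where
  carrier := {x | ∑ v, x v * signVec m n v = 0}
  zero_mem' := by simp
  add_mem' {x y} hx hy := by
    simp only [Set.mem_ofPred_eq, Pi.add_apply, add_mul, Finset.sum_add_distrib] at *
    rw [hx, hy, add_zero]
  smul_mem' c x hx := by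
    simp only [Set.mem_ofPred_eq, Pi.smul_apply, smul_eq_mul, mul_assoc, ← Finset.mul_sum] at *
    rw [hx, mul_zero]

/-- `N_ℚ = ℚ^{m+n} / ⟨(1,-1)⟩`. -/
abbrev NQ (m n : ℕ) : Type := (Vert m n → ℚ) ⧸ Submodule.span ℚ {signVec m n}

/-- The standard pairing of a coordinate vector with an element of `M_ℚ`. -/
def coordPairing (m n : ℕ) : (Vert m n → ℚ) →ₗ[ℚ] MQ m n →ₗ[ℚ] ℚ :=
  LinearMap.mk₂ ℚ (fun x y => ∑ v, (y : Vert m n → ℚ) v * x v)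
    (by intro x x' y; simp [mul_add, Finset.sum_add_distrib])
    (by
      intro c x y
      rw [smul_eq_mul, Finset.mul_sum]
      exact Finset.sum_congr rfl fun v _ => by simp [mul_left_comm])
    (by intro x y y'; simp [add_mul, Finset.sum_add_distrib])
    (by
      intro c x y
      rw [smul_eq_mul, Finset.mul_sum]
      exact Finset.sum_congr rfl fun v _ => by simp [mul_assoc])

theorem span_signVec_le_ker (m n : ℕ) :
    Submodule.span ℚ {signVec m n} ≤ LinearMap.ker (coordPairing m n) := by
  rw [Submodule.span_singleton_le_iff_mem, LinearMap.mem_ker]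
  ext y
  exact y.2

/-- The pairing `⟨y, x⟩` of `y ∈ M_ℚ` and `x ∈ N_ℚ`. -/
def pairing (m n : ℕ) : MQ m n →ₗ[ℚ] NQ m n →ₗ[ℚ] ℚ :=
  (Submodule.liftQ _ (coordPairing m n) (span_signVec_le_ker m n)).flip

theorem pairing_mk {m n : ℕ} (y : MQ m n) (x : Vert m n → ℚ) :
    pairing m n y (Submodule.Quotient.mk x) = ∑ v, (y : Vert m n → ℚ) v * x v := rfl

/-! ### Cones -/

/-- The dimension of a cone: the dimension of its linear span. -/
noncomputable def coneDim {E : Type*} [AddCommGroup E] [Module ℚ E] (C : PointedCone ℚ E) : ℕ :=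
  Module.finrank ℚ (Submodule.span ℚ (C : Set E))

/-- `τ` is the face of `σ` spanned by a family `R` of rays (subcones) of `σ`:
the smallest face of `σ` that contains all of them. -/
def IsFaceSpannedBy {E : Type*} [AddCommGroup E] [Module ℚ E]
    (σ : PointedCone ℚ E) (R : Set (PointedCone ℚ E)) (τ : PointedCone ℚ E) : Prop :=
  IsLeast {F : PointedCone ℚ E | F.IsFaceOf σ ∧ ∀ ρ ∈ R, ρ ≤ F} τ

/-- The vector `e^i + f^j` of `M_ℚ`. -/
def edgeVec {m n : ℕ} (i : Fin m) (j : Fin n) : MQ m n :=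
  ⟨Pi.single (Sum.inl i) 1 + Pi.single (Sum.inr j) 1, by
    simp [MQ, signVec, Pi.single_apply]⟩

/-- The dual edge cone `σ_G^∨ ⊆ M_ℚ`, generated by `e^i + f^j` for the edges `(i,j)` of `G`. -/
def dualEdgeCone {m n : ℕ} (G : SimpleGraph (Vert m n)) : PointedCone ℚ (MQ m n) :=
  PointedCone.hull ℚ {y | ∃ i j, G.Adj (Sum.inl i) (Sum.inr j) ∧ y = edgeVec i j}

/-- The edge cone `σ_G ⊆ N_ℚ`. -/
def edgeCone {m n : ℕ} (G : SimpleGraph (Vert m n)) : PointedCone ℚ (NQ m n) :=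
  PointedCone.dual (pairing m n) (dualEdgeCone G : Set (MQ m n))

/-- `H_y = {x ∈ N_ℚ | ⟨y, x⟩ = 0}`. -/
def hyperplane {m n : ℕ} (y : MQ m n) : Submodule ℚ (NQ m n) := LinearMap.ker (pairing m n y)

/-- `H_y ∩ σ_G`. -/
def hyperplaneSection {m n : ℕ} (G : SimpleGraph (Vert m n)) (y : MQ m n) :
    PointedCone ℚ (NQ m n) :=
  PointedCone.ofSubmodule (hyperplane y) ⊓ edgeCone G

/-- The annihilator `F^⊥ ⊆ N_ℚ` of a subset `F` of `M_ℚ`. -/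
def annihilator {m n : ℕ} (F : Set (MQ m n)) : Submodule ℚ (NQ m n) :=
  ⨅ y ∈ F, hyperplane y

/-- `F^* = F^⊥ ∩ σ_G`, for `F ⊆ σ_G^∨`. -/
def dualFace {m n : ℕ} (G : SimpleGraph (Vert m n)) (F : Set (MQ m n)) :
    PointedCone ℚ (NQ m n) :=
  PointedCone.ofSubmodule (annihilator F) ⊓ edgeCone G

/-! ### Independent sets -/

/-- `U₁`. -/
def U₁ (m n : ℕ) : Finset (Vert m n) := Finset.univ.filter fun v => v.isLeft

/-- `U₂`. -/
def U₂ (m n : ℕ) : Finset (Vert m n) := Finset.univ.filter fun v => v.isRight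

open Classical in
/-- The neighbour set `N(A)`. -/
noncomputable def nbr {m n : ℕ} (G : SimpleGraph (Vert m n)) (A : Finset (Vert m n)) :
    Finset (Vert m n) :=
  Finset.univ.filter fun v => ∃ u ∈ A, G.Adj u v

/-- Independent sets are non-empty by convention. -/
def IsIndependent {m n : ℕ} (G : SimpleGraph (Vert m n)) (A : Finset (Vert m n)) : Prop :=
  A.Nonempty ∧ G.IsIndepSet (A : Set (Vert m n))

/-- Two-sided independent sets `A = A₁ ⊔ A₂` with `∅ ≠ A₁ ⊊ U₁` and `∅ ≠ A₂ ⊊ U₂`. -/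
def IsTwoSided {m n : ℕ} (G : SimpleGraph (Vert m n)) (A : Finset (Vert m n)) : Prop :=
  IsIndependent G A ∧
    (A ∩ U₁ m n).Nonempty ∧ A ∩ U₁ m n ⊂ U₁ m n ∧
    (A ∩ U₂ m n).Nonempty ∧ A ∩ U₂ m n ⊂ U₂ m n

/-- The collection `I_G^(*)`: the two-sided maximal independent sets, and the independent sets
`U_i \ {u}` (with `u ∈ U_i`) which are contained in no two-sided independent set. -/
def IsStarSet {m n : ℕ} (G : SimpleGraph (Vert m n)) (A : Finset (Vert m n)) : Prop :=
  (IsTwoSided G A ∧ Maximal (IsIndependent G) A) ∨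
    (IsIndependent G A ∧
      ((∃ u ∈ U₁ m n, A = U₁ m n \ {u}) ∨ (∃ u ∈ U₂ m n, A = U₂ m n \ {u})) ∧
      ∀ B, IsTwoSided G B → ¬ A ⊆ B)

/-- The induced subgraph `G[P]`, as a graph on all vertices (those outside `P` are isolated). -/
def inducedOn {m n : ℕ} (G : SimpleGraph (Vert m n)) (P : Finset (Vert m n)) :
    SimpleGraph (Vert m n) :=
  (G.induce (P : Set (Vert m n))).spanningCoe

open Classical in
/-- The spanning subgraph `G{A}` associated to an independent set `A`. -/
noncomputable def assocGraph {m n : ℕ} (G : SimpleGraph (Vert m n)) (A : Finset (Vert m n)) :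
    SimpleGraph (Vert m n) :=
  if A ⊆ U₁ m n then
    inducedOn G (A ∪ nbr G A) ⊔ inducedOn G ((U₁ m n \ A) ∪ (U₂ m n \ nbr G A))
  else if A ⊆ U₂ m n then
    inducedOn G (A ∪ nbr G A) ⊔ inducedOn G ((U₂ m n \ A) ∪ (U₁ m n \ nbr G A))
  else
    inducedOn G ((A ∩ U₁ m n) ∪ nbr G (A ∩ U₁ m n)) ⊔
      inducedOn G ((A ∩ U₂ m n) ∪ nbr G (A ∩ U₂ m n))

/-- The number of connected components of a graph. -/
noncomputable def numComponents {V : Type*} (G : SimpleGraph V) : ℕ :=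
  Nat.card G.ConnectedComponent

/-- First independent sets: those `A ∈ I_G^(*)` for which `G{A}` has two components. -/
def IsFirstIndependent {m n : ℕ} (G : SimpleGraph (Vert m n)) (A : Finset (Vert m n)) : Prop :=
  IsStarSet G A ∧ numComponents (assocGraph G A) = 2

/-- `𝓗_A = {x ∈ M_ℚ | ∑_{v ∈ A} x_v = ∑_{v ∈ N(A)} x_v}`. -/
def indepHyperplane {m n : ℕ} (G : SimpleGraph (Vert m n)) (A : Finset (Vert m n)) :
    Set (MQ m n) :=
  {x | ∑ v ∈ A, (x : Vert m n → ℚ) v = ∑ v ∈ nbr G A, (x : Vert m n → ℚ) v}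

open Classical in
/-- A non-empty one of the two parts `A₁ = A ∩ U₁`, `A₂ = A ∩ U₂` of `A`. -/
noncomputable def chosenSide {m n : ℕ} (A : Finset (Vert m n)) : Finset (Vert m n) :=
  if (A ∩ U₁ m n).Nonempty then A ∩ U₁ m n else A ∩ U₂ m n

/-- `π(A) = (𝓗_{A_i} ∩ σ_G^∨)^*` for an `i` with `A_i ≠ ∅`, as a subcone of `σ_G`. -/
noncomputable def extremalRay {m n : ℕ} (G : SimpleGraph (Vert m n)) (A : Finset (Vert m n)) :
    PointedCone ℚ (NQ m n) :=
  dualFace G (indepHyperplane G (chosenSide A) ∩ (dualEdgeCone G : Set (MQ m n)))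

/-! ### The intersection graph and its degree sequence -/

/-- `G[S] = ⋂_{A ∈ S} G{A}`, a spanning subgraph of `G`; it is `G` itself for `S = ∅`. -/
noncomputable def interGraph {m n : ℕ} (G : SimpleGraph (Vert m n))
    (S : Finset (Finset (Vert m n))) : SimpleGraph (Vert m n) :=
  G ⊓ ⨅ A ∈ S, assocGraph G A

theorem interGraph_le {m n : ℕ} (G : SimpleGraph (Vert m n))
    (S : Finset (Finset (Vert m n))) : interGraph G S ≤ G := inf_le_left

open Classical in
theorem degree_mem_MQ {m n : ℕ} (G : SimpleGraph (Vert m n))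
    (hG : G ≤ completeBipartiteGraph (Fin m) (Fin n)) :
    (fun v => (G.degree v : ℚ)) ∈ MQ m n := by
  have hl : ∀ i : Fin m, (G.degree (Sum.inl i) : ℚ)
      = ∑ j : Fin n, if G.Adj (Sum.inl i) (Sum.inr j) then 1 else 0 := by
    intro i
    have h : ∀ i' : Fin m, ¬ G.Adj (Sum.inl i) (Sum.inl i') := fun i' h => by
      simpa using hG h
    rw [← SimpleGraph.card_neighborFinset_eq_degree, SimpleGraph.neighborFinset_eq_filter,
      Finset.card_filter]
    rw [Fintype.sum_sum_type]
    push_cast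
    simp only [h, if_false, Finset.sum_const_zero, zero_add]
  have hr : ∀ j : Fin n, (G.degree (Sum.inr j) : ℚ)
      = ∑ i : Fin m, if G.Adj (Sum.inl i) (Sum.inr j) then 1 else 0 := by
    intro j
    have h : ∀ j' : Fin n, ¬ G.Adj (Sum.inr j) (Sum.inr j') := fun j' h => by
      simpa using hG h
    rw [← SimpleGraph.card_neighborFinset_eq_degree, SimpleGraph.neighborFinset_eq_filter,
      Finset.card_filter]
    rw [Fintype.sum_sum_type]
    push_cast
    simp only [h, if_false, Finset.sum_const_zero, add_zero, G.adj_comm (Sum.inr j)]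
  change ∑ v, (G.degree v : ℚ) * signVec m n v = 0
  rw [Fintype.sum_sum_type]
  simp only [hl, hr, signVec, Sum.elim_inl, Sum.elim_inr, mul_one, mul_neg,
    Finset.sum_neg_distrib]
  rw [Finset.sum_comm, add_neg_cancel]

open Classical in
/-- The degree sequence of a graph contained in `K_{m,n}`, as an element of `M_ℚ`. -/
noncomputable def degreeSeq {m n : ℕ} (G : SimpleGraph (Vert m n))
    (hG : G ≤ completeBipartiteGraph (Fin m) (Fin n)) : MQ m n :=
  ⟨fun v => (G.degree v : ℚ), degree_mem_MQ G hG⟩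

end EdgeCone

/-! The argument replaces the family of rays by a single point. For `B` equal to a one-sided part
`A_i` of `A`, the functional `∑_{N(B)} y_v - ∑_B y_v` on `M_ℚ` is a vector `rayVec G B` of `N_ℚ`. It
is nonnegative on every edge vector of `G`, because a neighbour of `B` lies in `N(B)`, so it belongs
to `σ_G` and to `π(A)`. For `A ∈ I_G^(*)` it vanishes on exactly those edges of `G` that belong to
`G{A}` (`assocGraph_adj_iff`). A sum of nonnegative numbers is zero only if each of them is, so the
sum `raySum G S` vanishes on exactly the edges of `G[S]`.

In a cone cut out by finitely many inequalities, the smallest face through a point is given by the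
inequalities tight at that point (`mem_of_isFaceOf`). A face containing the rays contains `raySum G
S`, hence all of the face cut out by the edges of `G[S]`, and this face in turn contains every
`π(A)`. It equals `H_{Val_S} ∩ σ_G` since `Val_S` is the sum of the edge vectors of `G[S]`.

The span of this face is the annihilator of those edge vectors (`span_eq_of_mem_iff`). Lifted to
`ℚ^{m+n}`, the annihilator has one dimension for each component of `G[S]`. With `c` components the
face has dimension `c - 1` and the dual edge cone of `G[S]` has dimension `m + n - c`, which links
the three conditions. -/

namespace EdgeCone

open Filter Topology

/-! ### Cones cut out by finitely many linear functionals -/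

section Polyhedral

variable {E ι : Type*} [AddCommGroup E] [Module ℚ E] [Finite ι] {f : ι → E →ₗ[ℚ] ℚ}
  {σ : PointedCone ℚ E}

/-- A point of a polyhedral cone can be moved a little in any direction along which the
functionals vanishing at the point vanish. -/
theorem exists_pos_add_smul_mem (hσ : ∀ x, x ∈ σ ↔ ∀ e, 0 ≤ f e x) {x₀ y : E} (hx₀ : x₀ ∈ σ)
    (hy : ∀ e, f e x₀ = 0 → f e y = 0) : ∃ ε : ℚ, 0 < ε ∧ x₀ + ε • y ∈ σ := by
  have key : ∀ e, ∀ᶠ ε : ℚ in 𝓝[>] 0, 0 ≤ f e (x₀ + ε • y) := by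
    intro e
    simp only [map_add, map_smul, smul_eq_mul]
    -- A tight functional stays zero along `y`; a strictly positive one stays positive for small `ε`
    -- by continuity. Finiteness of the index set then gives a common `ε`.
    rcases ((hσ x₀).1 hx₀ e).eq_or_lt with h | h
    · simp [← h, hy e h.symm]
    · have hc : Tendsto (fun ε : ℚ => f e x₀ + ε * f e y) (𝓝[>] 0) (𝓝 (f e x₀ + 0 * f e y)) :=
        Tendsto.mono_left (Continuous.tendsto (by fun_prop) 0) nhdsWithin_le_nhds
      rw [zero_mul, add_zero] at hc
      exact (hc.eventually (lt_mem_nhds h)).mono fun _ h => h.le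
  obtain ⟨ε, h, hε⟩ := ((eventually_all.2 key).and self_mem_nhdsWithin).exists
  exact ⟨ε, hε, (hσ _).2 h⟩

/-- The smallest face of a polyhedral cone through the point `x₀` consists of the points of the
cone where all the functionals vanishing at `x₀` vanish. -/
theorem mem_of_isFaceOf (hσ : ∀ x, x ∈ σ ↔ ∀ e, 0 ≤ f e x) {x₀ x : E} {F : PointedCone ℚ E}
    (hF : F.IsFaceOf σ) (hx₀ : x₀ ∈ F) (hx : x ∈ σ) (h : ∀ e, f e x₀ = 0 → f e x = 0) :
    x ∈ F := by
  -- Moving backwards writes `x₀ = ε • x + (x₀ - ε • x)` with both summands in `σ`, so the face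
  -- property puts `x` in `F`.
  obtain ⟨ε, hε, hm⟩ := exists_pos_add_smul_mem (y := -x) hσ (hF.le hx₀)
    (fun e he => by rw [map_neg, h e he, neg_zero])
  refine hF.mem_of_smul_add_mem hx hm hε ?_
  simpa using hx₀

/-- The linear span of the smallest face of a polyhedral cone through `x₀`. -/
theorem span_eq_of_mem_iff (hσ : ∀ x, x ∈ σ ↔ ∀ e, 0 ≤ f e x) {x₀ : E} (hx₀ : x₀ ∈ σ)
    {F : PointedCone ℚ E} (hF : ∀ x, x ∈ F ↔ x ∈ σ ∧ ∀ e, f e x₀ = 0 → f e x = 0)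
    {W : Submodule ℚ E} (hW : ∀ x, x ∈ W ↔ ∀ e, f e x₀ = 0 → f e x = 0) :
    Submodule.span ℚ (F : Set E) = W := by
  apply le_antisymm
  · rw [Submodule.span_le]
    exact fun x hx => (hW x).2 ((hF x).1 hx).2
  · intro y hy
    have hy' := (hW y).1 hy
    obtain ⟨ε, hε, hm⟩ := exists_pos_add_smul_mem hσ hx₀ hy'
    have h₁ : x₀ + ε • y ∈ F := (hF _).2 ⟨hm, fun e he => by simp [he, hy' e he]⟩
    have h₀ : x₀ ∈ F := (hF _).2 ⟨hx₀, fun _ he => he⟩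
    have h := Submodule.smul_mem _ ε⁻¹
      (Submodule.sub_mem _ (Submodule.subset_span (R := ℚ) h₁) (Submodule.subset_span h₀))
    rwa [add_sub_cancel_left, smul_smul, inv_mul_cancel₀ hε.ne', one_smul] at h

end Polyhedral

variable {m n : ℕ}

/-! ### Edge vectors -/

theorem pairing_edgeVec_mk (i : Fin m) (j : Fin n) (x : Vert m n → ℚ) :
    pairing m n (edgeVec i j) (Submodule.Quotient.mk x) = x (Sum.inl i) + x (Sum.inr j) := by
  rw [pairing_mk]
  simp [edgeVec, Pi.single_apply, add_mul, Finset.sum_add_distrib]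

/-- The generators of the dual edge cone. -/
def edgeVecs (G : SimpleGraph (Vert m n)) : Set (MQ m n) :=
  {y | ∃ i j, G.Adj (Sum.inl i) (Sum.inr j) ∧ y = edgeVec i j}

theorem edgeVec_mem_dualEdgeCone {G : SimpleGraph (Vert m n)} {i : Fin m} {j : Fin n}
    (h : G.Adj (Sum.inl i) (Sum.inr j)) : edgeVec i j ∈ dualEdgeCone G :=
  PointedCone.subset_hull ⟨i, j, h, rfl⟩

theorem mem_edgeCone {G : SimpleGraph (Vert m n)} {x : NQ m n} :
    x ∈ edgeCone G ↔
      ∀ i j, G.Adj (Sum.inl i) (Sum.inr j) → 0 ≤ pairing m n (edgeVec i j) x := by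
  rw [edgeCone, dualEdgeCone, PointedCone.dual_hull, PointedCone.mem_dual]
  constructor
  · exact fun h i j hij => h ⟨i, j, hij, rfl⟩
  · rintro h _ ⟨i, j, hij, rfl⟩
    exact h i j hij

theorem mem_annihilator_edgeVecs {H : SimpleGraph (Vert m n)} {x : NQ m n} :
    x ∈ annihilator (edgeVecs H) ↔
      ∀ i j, H.Adj (Sum.inl i) (Sum.inr j) → pairing m n (edgeVec i j) x = 0 := by
  simp only [annihilator, hyperplane, Submodule.mem_iInf, LinearMap.mem_ker]
  constructor
  · exact fun h i j hij => h _ ⟨i, j, hij, rfl⟩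
  · rintro h _ ⟨i, j, hij, rfl⟩
    exact h i j hij

theorem span_dualEdgeCone (H : SimpleGraph (Vert m n)) :
    Submodule.span ℚ (dualEdgeCone H : Set (MQ m n)) = Submodule.span ℚ (edgeVecs H) := by
  apply le_antisymm
  · rw [Submodule.span_le]
    exact PointedCone.hull_le_span (R := ℚ) (edgeVecs H)
  · exact Submodule.span_mono PointedCone.subset_hull

/-! ### Dimension counts -/

/-- The vectors `x` with `x_u + x_v = 0` for all edges. -/
def edgeKernel (H : SimpleGraph (Vert m n)) : Submodule ℚ (Vert m n → ℚ) :=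
  (annihilator (edgeVecs H)).comap (Submodule.mkQ _)

theorem mem_edgeKernel {H : SimpleGraph (Vert m n)} {x : Vert m n → ℚ} :
    x ∈ edgeKernel H ↔
      ∀ i j, H.Adj (Sum.inl i) (Sum.inr j) → x (Sum.inl i) + x (Sum.inr j) = 0 := by
  rw [edgeKernel, Submodule.mem_comap, mem_annihilator_edgeVecs]
  simp only [Submodule.mkQ_apply, pairing_edgeVec_mk]

theorem signVec_mul_self (v : Vert m n) : signVec m n v * signVec m n v = 1 := by
  cases v <;> simp [signVec]

/-- Multiplying by `signVec` turns `x_u + x_v = 0` on edges into equality of values on adjacent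
vertices, so the solutions are the functions constant on components. -/
theorem finrank_edgeKernel {H : SimpleGraph (Vert m n)}
    (hH : H ≤ completeBipartiteGraph (Fin m) (Fin n)) :
    Module.finrank ℚ (edgeKernel H) = numComponents H := by
  classical
  have hadj : ∀ x ∈ edgeKernel H, ∀ u v, H.Adj u v →
      signVec m n u * x u = signVec m n v * x v := by
    intro x hx u v huv
    rw [mem_edgeKernel] at hx
    have hb := hH huv
    rcases u with i | j <;> rcases v with i' | j' <;> simp at hb
    · have := hx i j' huv
      simp only [signVec, Sum.elim_inl, Sum.elim_inr]
      linarith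
    · have := hx i' j huv.symm
      simp only [signVec, Sum.elim_inl, Sum.elim_inr]
      linarith
  have hwalk : ∀ x ∈ edgeKernel H, ∀ u v (p : H.Walk u v), p.IsPath →
      signVec m n u * x u = signVec m n v * x v := by
    intro x hx u v p _
    induction p with
    | nil => rfl
    | cons h p ih => exact (hadj x hx _ _ h).trans (ih (by simp_all))
  let e : edgeKernel H ≃ₗ[ℚ] (H.ConnectedComponent → ℚ) :=
    { toFun := fun x c =>
        c.lift (fun v => signVec m n v * (x : Vert m n → ℚ) v) (hwalk x x.2)
      map_add' := fun x y => by
        ext c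
        induction c using SimpleGraph.ConnectedComponent.ind
        simp [mul_add]
      map_smul' := fun a x => by
        ext c
        induction c using SimpleGraph.ConnectedComponent.ind
        simp [mul_left_comm]
      invFun := fun g => ⟨fun v => signVec m n v * g (H.connectedComponentMk v), by
        rw [mem_edgeKernel]
        intro i j hij
        rw [SimpleGraph.ConnectedComponent.connectedComponentMk_eq_of_adj hij]
        simp [signVec]⟩
      left_inv := fun x => by
        ext v
        simp [← mul_assoc, signVec_mul_self]
      right_inv := fun g => by
        ext c
        induction c using SimpleGraph.ConnectedComponent.ind
        simp [← mul_assoc, signVec_mul_self] }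
  rw [e.finrank_eq, Module.finrank_pi, numComponents, Nat.card_eq_fintype_card]

/-- Inside `ℚ^{m+n}` the edge kernel is the orthogonal complement of the span of the edge vectors
under the nondegenerate dot product. -/
theorem coneDim_dualEdgeCone_add_finrank (H : SimpleGraph (Vert m n)) :
    coneDim (dualEdgeCone H) + Module.finrank ℚ (edgeKernel H) = m + n := by
  let B : LinearMap.BilinForm ℚ (Vert m n → ℚ) := dotProductBilin ℚ ℚ
  have hB : LinearMap.ker B = ⊥ := by
    rw [LinearMap.ker_eq_bot']
    exact fun x hx => dotProduct_eq_zero x fun y => LinearMap.congr_fun hx y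
  have hker : B.orthogonal ((Submodule.span ℚ (edgeVecs H)).map (MQ m n).subtype)
      = edgeKernel H := by
    ext x
    have hdot : ∀ i j, B (edgeVec i j : MQ m n) x = x (Sum.inl i) + x (Sum.inr j) :=
      fun i j => pairing_edgeVec_mk i j x
    rw [Submodule.map_span, mem_edgeKernel, LinearMap.BilinForm.mem_orthogonal_iff]
    constructor
    · intro h i j hij
      rw [← hdot]
      exact h _ (Submodule.subset_span ⟨_, ⟨i, j, hij, rfl⟩, rfl⟩)
    · intro h y hy
      change y ∈ LinearMap.ker (B.flip x)
      refine (Submodule.span_le.2 ?_) hy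
      rintro _ ⟨_, ⟨i, j, hij, rfl⟩, rfl⟩
      exact (hdot i j).trans (h i j hij)
  have h := LinearMap.BilinForm.finrank_add_finrank_orthogonal' (B := B)
    ((Submodule.span ℚ (edgeVecs H)).map (MQ m n).subtype)
  rw [hker, hB, inf_bot_eq, finrank_bot, add_zero] at h
  rw [coneDim, span_dualEdgeCone, ← Submodule.finrank_map_subtype_eq (MQ m n), h]
  simp

/-- The edge kernel is the full preimage of the annihilator in `ℚ^{m+n}`, so passing to `N_ℚ` loses
exactly the line of `signVec`. A vertex must exist for this to be a line. -/
theorem finrank_annihilator_add_one (H : SimpleGraph (Vert m n)) [Nonempty (Vert m n)] :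
    Module.finrank ℚ (annihilator (edgeVecs H)) + 1 = Module.finrank ℚ (edgeKernel H) := by
  have hne : signVec m n ≠ 0 := by
    intro h
    obtain ⟨v⟩ := ‹Nonempty (Vert m n)›
    simpa [h] using signVec_mul_self v
  let g : edgeKernel H →ₗ[ℚ] annihilator (edgeVecs H) :=
    (Submodule.mkQ (Submodule.span ℚ {signVec m n})).restrict fun x hx => hx
  have hsurj : Function.Surjective g := by
    rintro ⟨y, hy⟩
    obtain ⟨x, rfl⟩ := Submodule.mkQ_surjective _ y
    exact ⟨⟨x, hy⟩, rfl⟩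
  have hle : Submodule.span ℚ {signVec m n} ≤ edgeKernel H := by
    rw [Submodule.span_singleton_le_iff_mem, mem_edgeKernel]
    simp [signVec]
  have hker : LinearMap.ker g = (Submodule.span ℚ {signVec m n}).comap (edgeKernel H).subtype := by
    ext x
    rw [LinearMap.mem_ker, Submodule.mem_comap, ← Submodule.Quotient.mk_eq_zero]
    exact Subtype.ext_iff
  have h := LinearMap.finrank_range_add_finrank_ker g
  rw [LinearMap.range_eq_top.2 hsurj, finrank_top, hker,
    (Submodule.comapSubtypeEquivOfLe hle).finrank_eq, finrank_span_singleton hne] at h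
  exact h

/-! ### The rays -/

/-- The functional `∑_{v ∈ N(B)} y_v - ∑_{v ∈ B} y_v`, as an element of `N_ℚ`. -/
noncomputable def rayVec (G : SimpleGraph (Vert m n)) (B : Finset (Vert m n)) : NQ m n :=
  open Classical in
  Submodule.Quotient.mk fun v => (if v ∈ nbr G B then 1 else 0) - (if v ∈ B then 1 else 0)

theorem pairing_rayVec (G : SimpleGraph (Vert m n)) (B : Finset (Vert m n)) (y : MQ m n) :
    pairing m n y (rayVec G B) =
      ∑ v ∈ nbr G B, (y : Vert m n → ℚ) v - ∑ v ∈ B, (y : Vert m n → ℚ) v := by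
  classical
  rw [rayVec, pairing_mk]
  simp [mul_sub, Finset.sum_sub_distrib]

theorem mem_indepHyperplane_iff {G : SimpleGraph (Vert m n)} {B : Finset (Vert m n)}
    {y : MQ m n} : y ∈ indepHyperplane G B ↔ pairing m n y (rayVec G B) = 0 := by
  rw [pairing_rayVec, sub_eq_zero, eq_comm]
  rfl

theorem mem_nbr {G : SimpleGraph (Vert m n)} {B : Finset (Vert m n)} {v : Vert m n} :
    v ∈ nbr G B ↔ ∃ u ∈ B, G.Adj u v := by
  simp [nbr]

theorem inducedOn_adj {G : SimpleGraph (Vert m n)} {P : Finset (Vert m n)} {u v : Vert m n} :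
    (inducedOn G P).Adj u v ↔ G.Adj u v ∧ u ∈ P ∧ v ∈ P := by
  simp only [inducedOn, SimpleGraph.map_adj, SimpleGraph.comap_adj,
    Function.Embedding.subtype_apply]
  constructor
  · rintro ⟨a, b, h, rfl, rfl⟩
    exact ⟨h, a.2, b.2⟩
  · rintro ⟨h, hu, hv⟩
    exact ⟨⟨u, hu⟩, ⟨v, hv⟩, h, rfl, rfl⟩

theorem inl_mem_U₁ (i : Fin m) : Sum.inl i ∈ U₁ m n := by simp [U₁]
theorem inr_notMem_U₁ (j : Fin n) : Sum.inr j ∉ U₁ m n := by simp [U₁]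
theorem inr_mem_U₂ (j : Fin n) : Sum.inr j ∈ U₂ m n := by simp [U₂]
theorem inl_notMem_U₂ (i : Fin m) : Sum.inl i ∉ U₂ m n := by simp [U₂]

theorem not_adj_inl {G : SimpleGraph (Vert m n)}
    (hG : G ≤ completeBipartiteGraph (Fin m) (Fin n)) (i i' : Fin m) :
    ¬ G.Adj (Sum.inl i) (Sum.inl i') := fun h => by simpa using hG h

theorem not_adj_inr {G : SimpleGraph (Vert m n)}
    (hG : G ≤ completeBipartiteGraph (Fin m) (Fin n)) (j j' : Fin n) :
    ¬ G.Adj (Sum.inr j) (Sum.inr j') := fun h => by simpa using hG h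

/-- A set contained in one of the two vertex classes. -/
def IsOneSided (B : Finset (Vert m n)) : Prop := B ⊆ U₁ m n ∨ B ⊆ U₂ m n

open Classical in
theorem pairing_edgeVec_rayVec (G : SimpleGraph (Vert m n)) (B : Finset (Vert m n))
    (i : Fin m) (j : Fin n) :
    pairing m n (edgeVec i j) (rayVec G B) =
      ((if Sum.inl i ∈ nbr G B then 1 else 0) - (if Sum.inl i ∈ B then 1 else 0)) +
      ((if Sum.inr j ∈ nbr G B then 1 else 0) - (if Sum.inr j ∈ B then 1 else 0)) := by
  rw [rayVec, pairing_edgeVec_mk]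

theorem isOneSided_chosenSide (A : Finset (Vert m n)) : IsOneSided (chosenSide A) := by
  unfold chosenSide
  split_ifs
  · exact .inl Finset.inter_subset_right
  · exact .inr Finset.inter_subset_right

/-- The value of the ray vector on an edge, for a subset of `U₁`. -/
theorem pairing_edgeVec_rayVec_of_subset_U₁ {G : SimpleGraph (Vert m n)}
    (hG : G ≤ completeBipartiteGraph (Fin m) (Fin n)) {B : Finset (Vert m n)}
    (hB : B ⊆ U₁ m n) (i : Fin m) (j : Fin n) :
    pairing m n (edgeVec i j) (rayVec G B) =
      open Classical in
      (if Sum.inr j ∈ nbr G B then 1 else 0) - (if Sum.inl i ∈ B then 1 else 0) := by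
  have h₁ : Sum.inr j ∉ B := fun h => inr_notMem_U₁ j (hB h)
  have h₂ : Sum.inl i ∉ nbr G B := by
    rw [mem_nbr]
    rintro ⟨u | u, hu, h⟩
    · exact not_adj_inl hG _ _ h
    · exact inr_notMem_U₁ u (hB hu)
  rw [pairing_edgeVec_rayVec, if_neg h₁, if_neg h₂]
  ring

/-- The value of the ray vector on an edge, for a subset of `U₂`. -/
theorem pairing_edgeVec_rayVec_of_subset_U₂ {G : SimpleGraph (Vert m n)}
    (hG : G ≤ completeBipartiteGraph (Fin m) (Fin n)) {B : Finset (Vert m n)}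
    (hB : B ⊆ U₂ m n) (i : Fin m) (j : Fin n) :
    pairing m n (edgeVec i j) (rayVec G B) =
      open Classical in
      (if Sum.inl i ∈ nbr G B then 1 else 0) - (if Sum.inr j ∈ B then 1 else 0) := by
  have h₁ : Sum.inl i ∉ B := fun h => inl_notMem_U₂ i (hB h)
  have h₂ : Sum.inr j ∉ nbr G B := by
    rw [mem_nbr]
    rintro ⟨u | u, hu, h⟩
    · exact inl_notMem_U₂ u (hB hu)
    · exact not_adj_inr hG _ _ h
  rw [pairing_edgeVec_rayVec, if_neg h₁, if_neg h₂]
  ring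

theorem rayVec_mem_edgeCone {G : SimpleGraph (Vert m n)}
    (hG : G ≤ completeBipartiteGraph (Fin m) (Fin n)) {B : Finset (Vert m n)}
    (hB : IsOneSided B) : rayVec G B ∈ edgeCone G := by
  rw [mem_edgeCone]
  intro i j hij
  rcases hB with hB | hB
  · rw [pairing_edgeVec_rayVec_of_subset_U₁ hG hB]
    have : Sum.inl i ∈ B → Sum.inr j ∈ nbr G B := fun h => mem_nbr.2 ⟨_, h, hij⟩
    split_ifs <;> simp_all
  · rw [pairing_edgeVec_rayVec_of_subset_U₂ hG hB]
    have : Sum.inr j ∈ B → Sum.inl i ∈ nbr G B := fun h => mem_nbr.2 ⟨_, h, hij.symm⟩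
    split_ifs <;> simp_all

/-- A maximal independent set contains every vertex without neighbours in it. -/
theorem mem_of_maximal {G : SimpleGraph (Vert m n)} {A : Finset (Vert m n)}
    (hA : Maximal (IsIndependent G) A) {v : Vert m n} (hv : v ∉ nbr G A) : v ∈ A := by
  classical
  have hins : IsIndependent G (insert v A) := by
    refine ⟨Finset.insert_nonempty _ _, ?_⟩
    rw [Finset.coe_insert]
    exact hA.prop.2.insert fun u hu _ =>
      ⟨fun h => hv (mem_nbr.2 ⟨u, hu, h.symm⟩), fun h => hv (mem_nbr.2 ⟨u, hu, h⟩)⟩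
  exact hA.le_of_ge hins (Finset.subset_insert v A) (Finset.mem_insert_self v A)

/-- The edges of `G{A}` are the edges of `G` in the hyperplane of `A`. -/
theorem assocGraph_adj_iff {G : SimpleGraph (Vert m n)}
    (hG : G ≤ completeBipartiteGraph (Fin m) (Fin n)) {A : Finset (Vert m n)}
    (hA : IsStarSet G A) {i : Fin m} {j : Fin n} (hij : G.Adj (Sum.inl i) (Sum.inr j)) :
    (assocGraph G A).Adj (Sum.inl i) (Sum.inr j) ↔
      pairing m n (edgeVec i j) (rayVec G (chosenSide A)) = 0 := by
  classical
  rcases hA with ⟨hts, hmax⟩ | ⟨hind, hU, -⟩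
  · obtain ⟨-, h₁, -, h₂, -⟩ := hts
    have hn₁ : ¬ A ⊆ U₁ m n := by
      obtain ⟨v, hv⟩ := h₂
      rw [Finset.mem_inter] at hv
      rcases v with v | v
      · exact absurd hv.2 (inl_notMem_U₂ v)
      · exact fun h => inr_notMem_U₁ v (h hv.1)
    have hn₂ : ¬ A ⊆ U₂ m n := by
      obtain ⟨v, hv⟩ := h₁
      rw [Finset.mem_inter] at hv
      rcases v with v | v
      · exact fun h => inl_notMem_U₂ v (h hv.1)
      · exact absurd hv.2 (inr_notMem_U₁ v)
    -- For a maximal independent set the neighbourhood is the complement.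
    have hnbr : ∀ v, v ∈ nbr G A ↔ v ∉ A := by
      refine fun v => ⟨?_, fun hv => by_contra fun h => hv (mem_of_maximal hmax h)⟩
      rw [mem_nbr]
      rintro ⟨u, hu, huv⟩ hv
      exact hmax.prop.2 hu hv huv.ne huv
    have hN₁ : Sum.inr j ∈ nbr G (A ∩ U₁ m n) ↔ Sum.inr j ∉ A := by
      rw [← hnbr, mem_nbr, mem_nbr]
      refine ⟨fun ⟨u, hu, h⟩ => ⟨u, (Finset.mem_inter.1 hu).1, h⟩, ?_⟩
      rintro ⟨u | u, hu, h⟩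
      · exact ⟨_, Finset.mem_inter.2 ⟨hu, inl_mem_U₁ u⟩, h⟩
      · exact absurd h (not_adj_inr hG _ _)
    have hN₂ : Sum.inl i ∈ nbr G (A ∩ U₂ m n) ↔ Sum.inl i ∉ A := by
      rw [← hnbr, mem_nbr, mem_nbr]
      refine ⟨fun ⟨u, hu, h⟩ => ⟨u, (Finset.mem_inter.1 hu).1, h⟩, ?_⟩
      rintro ⟨u | u, hu, h⟩
      · exact absurd h (not_adj_inl hG _ _)
      · exact ⟨_, Finset.mem_inter.2 ⟨hu, inr_mem_U₂ u⟩, h⟩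
    have hN₁' : Sum.inl i ∉ nbr G (A ∩ U₁ m n) := by
      rw [mem_nbr]
      rintro ⟨u | u, hu, h⟩
      · exact not_adj_inl hG _ _ h
      · exact inr_notMem_U₁ u (Finset.mem_inter.1 hu).2
    have hN₂' : Sum.inr j ∉ nbr G (A ∩ U₂ m n) := by
      rw [mem_nbr]
      rintro ⟨u | u, hu, h⟩
      · exact inl_notMem_U₂ u (Finset.mem_inter.1 hu).2
      · exact not_adj_inr hG _ _ h
    rw [chosenSide, if_pos h₁, pairing_edgeVec_rayVec_of_subset_U₁ hG Finset.inter_subset_right,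
      assocGraph, if_neg hn₁, if_neg hn₂]
    simp only [SimpleGraph.sup_adj, inducedOn_adj, Finset.mem_union, Finset.mem_inter, hN₁, hN₂,
      hN₁', hN₂', inl_mem_U₁, inl_notMem_U₂, inr_mem_U₂, inr_notMem_U₁, hij]
    -- The pairing is now `[j ∉ A] - [i ∈ A]`. As no edge has both ends in `A`, it vanishes iff
    -- exactly one end is in `A`, that is, iff the edge lies in one of the two induced parts.
    have hAij : ¬ (Sum.inl i ∈ A ∧ Sum.inr j ∈ A) := fun h => hmax.prop.2 h.1 h.2 hij.ne hij
    by_cases hi : Sum.inl i ∈ A <;> by_cases hj : Sum.inr j ∈ A <;> simp_all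
  · have hcases : A ⊆ U₁ m n ∨ A ⊆ U₂ m n := by
      rcases hU with ⟨u, -, rfl⟩ | ⟨u, -, rfl⟩
      exacts [.inl Finset.sdiff_subset, .inr Finset.sdiff_subset]
    obtain ⟨v, hv⟩ := hind.1
    rcases hcases with hA | hA
    · have hi : Sum.inl i ∈ A → Sum.inr j ∈ nbr G A := fun h => mem_nbr.2 ⟨_, h, hij⟩
      have hj : Sum.inr j ∉ A := fun h => inr_notMem_U₁ j (hA h)
      have hi' : Sum.inl i ∉ nbr G A := by
        rw [mem_nbr]
        rintro ⟨u | u, hu, h⟩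
        · exact not_adj_inl hG _ _ h
        · exact inr_notMem_U₁ u (hA hu)
      have hint : A ∩ U₁ m n = A := Finset.inter_eq_left.2 hA
      rw [chosenSide, hint, if_pos ⟨v, hv⟩, pairing_edgeVec_rayVec_of_subset_U₁ hG hA,
        assocGraph, if_pos hA]
      simp only [SimpleGraph.sup_adj, inducedOn_adj, Finset.mem_union, Finset.mem_sdiff,
        inl_mem_U₁, inl_notMem_U₂, inr_mem_U₂, inr_notMem_U₁, hij, hj, hi']
      by_cases h₁ : Sum.inl i ∈ A <;> by_cases h₂ : Sum.inr j ∈ nbr G A <;> simp_all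
    · have hj : Sum.inr j ∈ A → Sum.inl i ∈ nbr G A := fun h => mem_nbr.2 ⟨_, h, hij.symm⟩
      have hi : Sum.inl i ∉ A := fun h => inl_notMem_U₂ i (hA h)
      have hj' : Sum.inr j ∉ nbr G A := by
        rw [mem_nbr]
        rintro ⟨u | u, hu, h⟩
        · exact inl_notMem_U₂ u (hA hu)
        · exact not_adj_inr hG _ _ h
      have hdisj : ∀ w ∈ A, w ∉ U₁ m n := by
        rintro (w | w) hw
        · exact absurd (hA hw) (inl_notMem_U₂ w)
        · exact inr_notMem_U₁ w
      have hn₁ : ¬ A ⊆ U₁ m n := fun h => hdisj v hv (h hv)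
      have hn₁' : ¬ (A ∩ U₁ m n).Nonempty := by
        rintro ⟨w, hw⟩
        rw [Finset.mem_inter] at hw
        exact hdisj w hw.1 hw.2
      have hint : A ∩ U₂ m n = A := Finset.inter_eq_left.2 hA
      rw [chosenSide, if_neg hn₁', hint, pairing_edgeVec_rayVec_of_subset_U₂ hG hA,
        assocGraph, if_neg hn₁, if_pos hA]
      simp only [SimpleGraph.sup_adj, inducedOn_adj, Finset.mem_union, Finset.mem_sdiff,
        inl_mem_U₁, inl_notMem_U₂, inr_mem_U₂, inr_notMem_U₁, hij, hi, hj']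
      by_cases h₁ : Sum.inr j ∈ A <;> by_cases h₂ : Sum.inl i ∈ nbr G A <;> simp_all

theorem rayVec_mem_extremalRay {G : SimpleGraph (Vert m n)}
    (hG : G ≤ completeBipartiteGraph (Fin m) (Fin n)) (A : Finset (Vert m n)) :
    rayVec G (chosenSide A) ∈ extremalRay G A := by
  refine ⟨?_, rayVec_mem_edgeCone hG (isOneSided_chosenSide A)⟩
  simp only [annihilator, hyperplane]
  change _ ∈ (⨅ y ∈ _, LinearMap.ker (pairing m n y) : Submodule ℚ (NQ m n))
  simp only [Submodule.mem_iInf, LinearMap.mem_ker]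
  exact fun y hy => mem_indepHyperplane_iff.1 hy.1

theorem pairing_edgeVec_eq_zero_of_mem_extremalRay {G : SimpleGraph (Vert m n)}
    (hG : G ≤ completeBipartiteGraph (Fin m) (Fin n)) {A : Finset (Vert m n)}
    (hA : IsStarSet G A) {x : NQ m n} (hx : x ∈ extremalRay G A) {i : Fin m} {j : Fin n}
    (hij : G.Adj (Sum.inl i) (Sum.inr j)) (h : (assocGraph G A).Adj (Sum.inl i) (Sum.inr j)) :
    pairing m n (edgeVec i j) x = 0 := by
  have hx' : x ∈ annihilator (indepHyperplane G (chosenSide A) ∩ (dualEdgeCone G : Set _)) := hx.1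
  simp only [annihilator, hyperplane, Submodule.mem_iInf, LinearMap.mem_ker] at hx'
  exact hx' _ ⟨mem_indepHyperplane_iff.2 ((assocGraph_adj_iff hG hA hij).1 h),
    edgeVec_mem_dualEdgeCone hij⟩

/-! ### The face spanned by the rays -/

open Classical in
theorem degreeSeq_eq_sum {H : SimpleGraph (Vert m n)}
    (hH : H ≤ completeBipartiteGraph (Fin m) (Fin n)) :
    degreeSeq H hH =
      ∑ i, ∑ j, if H.Adj (Sum.inl i) (Sum.inr j) then edgeVec i j else 0 := by
  have hval : ∀ i j, ((if H.Adj (Sum.inl i) (Sum.inr j) then edgeVec i j else 0 : MQ m n) :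
      Vert m n → ℚ) = if H.Adj (Sum.inl i) (Sum.inr j) then
        Pi.single (Sum.inl i) 1 + Pi.single (Sum.inr j) 1 else 0 := by
    intro i j
    split_ifs <;> rfl
  ext v
  simp only [degreeSeq, AddSubmonoidClass.coe_finsetSum, hval, Finset.sum_apply]
  rw [← SimpleGraph.card_neighborFinset_eq_degree, SimpleGraph.neighborFinset_eq_filter,
    Finset.card_filter, Fintype.sum_sum_type]
  push_cast
  rcases v with i | j
  · simp only [not_adj_inl hH, if_false, Finset.sum_const_zero, zero_add]
    symm
    rw [Finset.sum_eq_single i]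
    · exact Finset.sum_congr rfl fun j _ => by split_ifs <;> simp
    · intro i' _ hi'
      refine Finset.sum_eq_zero fun j _ => ?_
      split_ifs <;> simp [hi'.symm]
    · simp
  · simp only [not_adj_inr hH, if_false, Finset.sum_const_zero, add_zero]
    refine Finset.sum_congr rfl fun i _ => ?_
    rw [Finset.sum_eq_single j]
    · simp only [H.adj_comm (Sum.inr j)]
      split_ifs <;> simp
    · intro j' _ hj'
      split_ifs <;> simp [hj'.symm]
    · simp

theorem mem_hyperplaneSection_degreeSeq {G H : SimpleGraph (Vert m n)} (hle : H ≤ G)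
    (hH : H ≤ completeBipartiteGraph (Fin m) (Fin n)) {x : NQ m n} :
    x ∈ hyperplaneSection G (degreeSeq H hH) ↔ x ∈ edgeCone G ∧
      ∀ i j, H.Adj (Sum.inl i) (Sum.inr j) → pairing m n (edgeVec i j) x = 0 := by
  classical
  have h0 : x ∈ hyperplaneSection G (degreeSeq H hH) ↔
      pairing m n (degreeSeq H hH) x = 0 ∧ x ∈ edgeCone G := Iff.rfl
  rw [h0, and_comm]
  refine and_congr_right fun hx => ?_
  have hnn : ∀ i j, 0 ≤ if H.Adj (Sum.inl i) (Sum.inr j)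
      then pairing m n (edgeVec i j) x else 0 := by
    intro i j
    split_ifs with h
    · exact mem_edgeCone.1 hx i j (hle h)
    · exact le_rfl
  have hsum : pairing m n (degreeSeq H hH) x = ∑ i, ∑ j, if H.Adj (Sum.inl i) (Sum.inr j)
      then pairing m n (edgeVec i j) x else 0 := by
    simp only [degreeSeq_eq_sum, map_sum, LinearMap.sum_apply]
    refine Finset.sum_congr rfl fun i _ => Finset.sum_congr rfl fun j _ => ?_
    split_ifs <;> simp
  rw [hsum, Finset.sum_eq_zero_iff_of_nonneg fun i _ => Finset.sum_nonneg fun j _ => hnn i j]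
  simp only [Finset.sum_eq_zero_iff_of_nonneg fun j _ => hnn _ j, Finset.mem_univ, true_imp_iff,
    ite_eq_right_iff]

theorem interGraph_adj {G : SimpleGraph (Vert m n)} {S : Finset (Finset (Vert m n))}
    {u v : Vert m n} :
    (interGraph G S).Adj u v ↔ G.Adj u v ∧ ∀ A ∈ S, (assocGraph G A).Adj u v := by
  simp only [interGraph, SimpleGraph.inf_adj, SimpleGraph.iInf_adj]
  exact ⟨fun h => ⟨h.1, fun A hA => (h.2.1 A).1 hA⟩,
    -- Adjacency in an infimum of graphs also demands `u ≠ v`, which adjacency in `G` supplies.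
    fun h => ⟨h.1, fun A => ⟨fun hA => h.2 A hA, h.1.ne⟩, h.1.ne⟩⟩

/-- The sum of the ray vectors of the members of `S`. -/
noncomputable def raySum (G : SimpleGraph (Vert m n)) (S : Finset (Finset (Vert m n))) :
    NQ m n :=
  ∑ A ∈ S, rayVec G (chosenSide A)

theorem raySum_mem_edgeCone {G : SimpleGraph (Vert m n)}
    (hG : G ≤ completeBipartiteGraph (Fin m) (Fin n)) (S : Finset (Finset (Vert m n))) :
    raySum G S ∈ edgeCone G :=
  Submodule.sum_mem _ fun A _ => rayVec_mem_edgeCone hG (isOneSided_chosenSide A)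

/-- The sum of the ray vectors vanishes exactly on the edges of `G[S]`. -/
theorem pairing_edgeVec_raySum_eq_zero_iff {G : SimpleGraph (Vert m n)}
    (hG : G ≤ completeBipartiteGraph (Fin m) (Fin n)) {S : Finset (Finset (Vert m n))}
    (hS : ∀ A ∈ S, IsStarSet G A) {i : Fin m} {j : Fin n}
    (hij : G.Adj (Sum.inl i) (Sum.inr j)) :
    pairing m n (edgeVec i j) (raySum G S) = 0 ↔
      (interGraph G S).Adj (Sum.inl i) (Sum.inr j) := by
  rw [raySum, map_sum, Finset.sum_eq_zero_iff_of_nonneg, interGraph_adj]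
  · simp only [hij, true_and]
    exact forall₂_congr fun A hA => (assocGraph_adj_iff hG (hS A hA) hij).symm
  · exact fun A _ => mem_edgeCone.1 (rayVec_mem_edgeCone hG (isOneSided_chosenSide A)) i j hij

/-- The functionals cutting out `σ_G`, indexed by the edges of `G`. -/
def edgeFunctional (G : SimpleGraph (Vert m n))
    (e : {e : Fin m × Fin n // G.Adj (Sum.inl e.1) (Sum.inr e.2)}) : NQ m n →ₗ[ℚ] ℚ :=
  pairing m n (edgeVec e.1.1 e.1.2)

theorem mem_edgeCone_iff_edgeFunctional (G : SimpleGraph (Vert m n)) (x : NQ m n) :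
    x ∈ edgeCone G ↔ ∀ e, 0 ≤ edgeFunctional G e x := by
  rw [mem_edgeCone]
  exact ⟨fun h e => h _ _ e.2, fun h i j hij => h ⟨(i, j), hij⟩⟩

theorem forall_edgeFunctional_iff {G : SimpleGraph (Vert m n)}
    (hG : G ≤ completeBipartiteGraph (Fin m) (Fin n)) {S : Finset (Finset (Vert m n))}
    (hS : ∀ A ∈ S, IsStarSet G A) (x : NQ m n) :
    (∀ e, edgeFunctional G e (raySum G S) = 0 → edgeFunctional G e x = 0) ↔
      ∀ i j, (interGraph G S).Adj (Sum.inl i) (Sum.inr j) →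
        pairing m n (edgeVec i j) x = 0 := by
  constructor
  · intro h i j hij
    have hij' := interGraph_le G S hij
    exact h ⟨(i, j), hij'⟩ ((pairing_edgeVec_raySum_eq_zero_iff hG hS hij').2 hij)
  · intro h e he
    exact h _ _ ((pairing_edgeVec_raySum_eq_zero_iff hG hS e.2).1 he)

theorem isFaceSpannedBy_hyperplaneSection {G : SimpleGraph (Vert m n)}
    (hG : G ≤ completeBipartiteGraph (Fin m) (Fin n)) {S : Finset (Finset (Vert m n))}
    (hS : ∀ A ∈ S, IsStarSet G A) :
    IsFaceSpannedBy (edgeCone G) (extremalRay G '' (S : Set (Finset (Vert m n))))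
      (hyperplaneSection G (degreeSeq (interGraph G S) ((interGraph_le G S).trans hG))) := by
  refine ⟨⟨⟨inf_le_right, ?_⟩, ?_⟩, ?_⟩
  · intro x y a hx hy ha h
    rw [mem_hyperplaneSection_degreeSeq (interGraph_le G S)] at h ⊢
    refine ⟨hx, fun i j hij => ?_⟩
    have h1 := h.2 i j hij
    have hx' := mem_edgeCone.1 hx i j (interGraph_le G S hij)
    have hy' := mem_edgeCone.1 hy i j (interGraph_le G S hij)
    rw [map_add, map_smul, smul_eq_mul] at h1
    have h2 := mul_nonneg ha.le hx'
    exact (mul_eq_zero.1 (by linarith : a * pairing m n (edgeVec i j) x = 0)).resolve_left ha.ne'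
  · rintro _ ⟨A, hA, rfl⟩ x hx
    rw [mem_hyperplaneSection_degreeSeq (interGraph_le G S)]
    refine ⟨hx.2, fun i j hij => ?_⟩
    rw [interGraph_adj] at hij
    exact pairing_edgeVec_eq_zero_of_mem_extremalRay hG (hS A hA) hx hij.1 (hij.2 A hA)
  · rintro F ⟨hF, hR⟩ x hx
    rw [mem_hyperplaneSection_degreeSeq (interGraph_le G S)] at hx
    -- The single point `raySum G S` stands in for all the rays: it lies in `F` as a sum of elements
    -- of the rays.
    refine mem_of_isFaceOf (mem_edgeCone_iff_edgeFunctional G) hF (x₀ := raySum G S) ?_ hx.1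
      ((forall_edgeFunctional_iff hG hS x).2 hx.2)
    exact Submodule.sum_mem _ fun A hA => hR _ ⟨A, hA, rfl⟩ (rayVec_mem_extremalRay hG A)

theorem coneDim_hyperplaneSection_add_one {G : SimpleGraph (Vert m n)} [Nonempty (Vert m n)]
    (hG : G ≤ completeBipartiteGraph (Fin m) (Fin n)) {S : Finset (Finset (Vert m n))}
    (hS : ∀ A ∈ S, IsStarSet G A) :
    coneDim (hyperplaneSection G
      (degreeSeq (interGraph G S) ((interGraph_le G S).trans hG))) + 1 =
        numComponents (interGraph G S) := by
  rw [← finrank_edgeKernel ((interGraph_le G S).trans hG), ← finrank_annihilator_add_one, coneDim,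
    span_eq_of_mem_iff (mem_edgeCone_iff_edgeFunctional G) (raySum_mem_edgeCone hG S)]
  · intro x
    rw [mem_hyperplaneSection_degreeSeq (interGraph_le G S), forall_edgeFunctional_iff hG hS]
  · intro x
    rw [mem_annihilator_edgeVecs, forall_edgeFunctional_iff hG hS]

end EdgeCone

/-! ### Comparison of the dimensions and the case of a simplicial-type spanning -/

theorem mainTheorem4 (m n d : ℕ) (G : SimpleGraph (Fin m ⊕ Fin n))
    (hG : G ≤ completeBipartiteGraph (Fin m) (Fin n)) (hconn : G.Connected)
    (S : Finset (Finset (Fin m ⊕ Fin n)))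
    (hS : ∀ A ∈ S, EdgeCone.IsFirstIndependent G A) (hd : S.card = d) :
    -- the rays `π(S)` span a face of dimension `d` iff `dim σ_{G[S]}^∨ = m + n - d - 1`
    ((∃ τ, EdgeCone.IsFaceSpannedBy (EdgeCone.edgeCone G)
          (EdgeCone.extremalRay G '' (S : Set (Finset (Fin m ⊕ Fin n)))) τ ∧
          EdgeCone.coneDim τ = d) ↔
        (EdgeCone.coneDim (EdgeCone.dualEdgeCone (EdgeCone.interGraph G S)) : ℤ)
          = (m : ℤ) + n - d - 1) ∧
    -- equivalently, iff `G[S]` has `d + 1` connected components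
    ((EdgeCone.coneDim (EdgeCone.dualEdgeCone (EdgeCone.interGraph G S)) : ℤ)
          = (m : ℤ) + n - d - 1 ↔
        EdgeCone.numComponents (EdgeCone.interGraph G S) = d + 1) ∧
    -- the face spanned by `π(S)` is `H_{Val_S} ∩ σ_G`
    EdgeCone.IsFaceSpannedBy (EdgeCone.edgeCone G)
      (EdgeCone.extremalRay G '' (S : Set (Finset (Fin m ⊕ Fin n))))
      (EdgeCone.hyperplaneSection G (EdgeCone.degreeSeq (EdgeCone.interGraph G S)
        ((EdgeCone.interGraph_le G S).trans hG))) ∧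
    -- if the cone generated by `π(S)` is itself a face of dimension `d`, then it is this face
    ((⨆ A ∈ S, EdgeCone.extremalRay G A).IsFaceOf (EdgeCone.edgeCone G) →
      EdgeCone.coneDim (⨆ A ∈ S, EdgeCone.extremalRay G A) = d →
        EdgeCone.numComponents (EdgeCone.interGraph G S) = d + 1 ∧
        (⨆ A ∈ S, EdgeCone.extremalRay G A) =
          EdgeCone.hyperplaneSection G (EdgeCone.degreeSeq (EdgeCone.interGraph G S)
            ((EdgeCone.interGraph_le G S).trans hG))) := by

  have hstar : ∀ A ∈ S, EdgeCone.IsStarSet G A := fun A hA => (hS A hA).1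
  have : Nonempty (EdgeCone.Vert m n) := hconn.nonempty
  have hface := EdgeCone.isFaceSpannedBy_hyperplaneSection hG hstar
  have hdim := EdgeCone.coneDim_hyperplaneSection_add_one hG hstar
  have hdual := EdgeCone.coneDim_dualEdgeCone_add_finrank (EdgeCone.interGraph G S)
  rw [EdgeCone.finrank_edgeKernel ((EdgeCone.interGraph_le G S).trans hG)] at hdual
  have h₁ : (∃ τ, EdgeCone.IsFaceSpannedBy (EdgeCone.edgeCone G)
      (EdgeCone.extremalRay G '' (S : Set (Finset (Fin m ⊕ Fin n)))) τ ∧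
      EdgeCone.coneDim τ = d) ↔ EdgeCone.numComponents (EdgeCone.interGraph G S) = d + 1 := by
    constructor
    · rintro ⟨τ, hτ, rfl⟩
      rw [hτ.unique hface, hdim]
    · exact fun h => ⟨_, hface, by omega⟩
  have h₂ : (EdgeCone.coneDim (EdgeCone.dualEdgeCone (EdgeCone.interGraph G S)) : ℤ)
      = (m : ℤ) + n - d - 1 ↔
      EdgeCone.numComponents (EdgeCone.interGraph G S) = d + 1 := by omega
  refine ⟨h₁.trans h₂.symm, h₂, hface, fun hF hFd => ?_⟩
  -- Any face containing the rays contains the cone they generate, so this cone, once it is a face,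
  -- is the least one.
  have hspan : EdgeCone.IsFaceSpannedBy (EdgeCone.edgeCone G)
      (EdgeCone.extremalRay G '' (S : Set (Finset (Fin m ⊕ Fin n))))
      (⨆ A ∈ S, EdgeCone.extremalRay G A) := by
    refine ⟨⟨hF, ?_⟩, ?_⟩
    · rintro _ ⟨A, hA, rfl⟩
      exact le_iSup₂_of_le A hA le_rfl
    · rintro F ⟨-, hR⟩
      exact iSup₂_le fun A hA => hR _ ⟨A, hA, rfl⟩
  exact ⟨h₁.1 ⟨_, hspan, hFd⟩, hspan.unique hface⟩
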